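/- Let $\mathcal S,\mathcal T,\mathcal U$ be triangulated categories with suspension $\Sigma$. View a triangulated category as an extriangulated category by $\mathbb E(Y,X)=\operatorname{Hom}(Y,\Sigma X)$, where $X\xrightarrow{f}W\xrightarrow{g}Y\overset{d}{\dashrightarrow}$ is an extriangle if and only if $X\xrightarrow{f}W\xrightarrow{g}Y\xrightarrow{d}\Sigma X$ is an exact triangle. For extriangulated categories $(\mathcal A,\mathbb E)$, $(\mathcal B,\mathbb F)$, $(\mathcal C,\mathbb G)$, a *biextriangulated functor* $(\mathsf F,\phi,\psi)\colon\mathcal A\times\mathcal B\to\mathcal C$ is a functor $\mathsf F$ of two variables with natural transformations of abelian group valued bifunctors $\phi^Y\colon\mathbb E(-,-)\Rightarrow\mathbb G(\mathsf F(-,Y),\mathsf F(-,Y))$ for $Y\in\mathcal B$ and $\psi^X\colon\mathbb F(-,-)\Rightarrow\mathbb G(\mathsf F(X,-),\mathsf F(X,-))$ for $X\in\mathcal A$ such that: * for all $X$ and $Y$, the pairs $(\mathsf F(-,Y),\phi^Y)$ and $(\mathsf F(X,-),\psi^X)$ are extriangulated functors, i.e. the functor is additive and, together with the natural transformation, sends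 extriangles to extriangles; * $\mathsf F(X,g)_*\,\phi^{Y}_{X',X}(d)=\mathsf F(X',g)^*\,\phi^{Y'}_{X',X}(d)$ for all $g\colon Y\to Y'$ in $\mathcal B$ and $d\in\mathbb E(X',X)$; * $\mathsf F(f,Y)_*\,\psi^{X}_{Y',Y}(e)=\mathsf F(f,Y')^*\,\psi^{X'}_{Y',Y}(e)$ for all $f\colon X\to X'$ in $\mathcal A$ and $e\in\mathbb F(Y',Y)$. It is *strong* if for all $d\in\mathbb E(X,X')$ and $e\in\mathbb F(Y,Y')$ $$\psi^{X'}_{Y,Y'}(e)\smile\phi^{Y}_{X,X'}(d)=-\,\phi^{Y'}_{X,X'}(d)\smile\psi^{X}_{Y,Y'}(e)\quad\text{in }\mathbb G^2(\mathsf F(X,Y),\mathsf F(X',Y')),$$ where $\mathbb G^2(Z,X)=\int^{W}\mathbb G(W,X)\otimes_{\mathbb Z}\mathbb G(Z,W)$ is the second extension group and $d\smile e$ is the class of $d\otimes e$. A *bitriangulated functor* $(\mathsf F,\theta,\zeta)\colon\mathcal S\times\mathcal T\to\mathcal U$ is a functor $\mathsf F$ of two variables with natural transformations $\theta\colon\mathsf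 F(\Sigma-,-)\to\Sigma\mathsf F(-,-)$ and $\zeta\colon\mathsf F(-,\Sigma-)\to\Sigma\mathsf F(-,-)$ such that $(\mathsf F(-,Y),\theta_{-,Y})$ and $(\mathsf F(X,-),\zeta_{X,-})$ are triangulated functors for all $X$ and $Y$, and such that $\Sigma\zeta_{X,Y}\circ\theta_{X,\Sigma Y}=-\,\Sigma\theta_{X,Y}\circ\zeta_{\Sigma X,Y}$ as morphisms $\mathsf F(\Sigma X,\Sigma Y)\to\Sigma^2\mathsf F(X,Y)$. Here $(\mathsf H,\tau)$, with $\tau\colon\mathsf H\Sigma\to\Sigma\mathsf H$ natural, is a *triangulated functor* if for each exact triangle $X\xrightarrow{f}W\xrightarrow{g}Y\xrightarrow{h}\Sigma X$ the triangle $\mathsf H X\xrightarrow{\mathsf H f}\mathsf H W\xrightarrow{\mathsf H g}\mathsf H Y\xrightarrow{\tau_X\circ\mathsf H h}\Sigma\mathsf H X$ is exact. **Proposition.** Let $(\mathsf F,\phi,\psi)\colon\mathcal S\times\mathcal T\to\mathcal U$ be a strong biextriangulated functor of triangulated categories, and set $$\theta_{X,Y}:=\phi^{Y}_{\Sigma X,X}(\mathrm{id}_{\Sigma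 X}),\qquad \zeta_{X,Y}:=\psi^{X}_{\Sigma Y,Y}(\mathrm{id}_{\Sigma Y}).$$ Then $(\mathsf F,\theta,\zeta)$ is a bitriangulated functor. Moreover, for every functor $\mathsf F\colon\mathcal S\times\mathcal T\to\mathcal U$, the assignment $(\phi,\psi)\mapsto(\theta,\zeta)$ is a bijection from the pairs that make $\mathsf F$ a strong biextriangulated functor to the pairs that make $\mathsf F$ a bitriangulated functor. Its inverse sends $(\theta,\zeta)$ to $\phi^{Y}_{X',X}(f)=\theta_{X,Y}\circ\mathsf F(f,Y)$ for $f\colon X'\to\Sigma X$ and $\psi^{X}_{Y',Y}(g)=\zeta_{X,Y}\circ\mathsf F(X,g)$ for $g\colon Y'\to\Sigma Y$. -/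

import Mathlib

open CategoryTheory CategoryTheory.Limits CategoryTheory.Pretriangulated Opposite
open scoped TensorProduct

universe w w₁ w₂ w₃ v v₁ v₂ v₃ u u₁ u₂ u₃

noncomputable section

namespace Extriangulated

/-! ### Bifunctors of extensions -/

section ExtGroups

variable {C : Type u} [Category.{v} C] (E : Cᵒᵖ ⥤ C ⥤ AddCommGrpCat.{w})

/-- The abelian group `E(Y, X)`. -/
abbrev ExtGroup (Y X : C) : Type w := ((E.obj (op Y)).obj X : AddCommGrpCat.{w})

/-- `a_* = E(Y, a) : E(Y, X) → E(Y, X')` for `a : X ⟶ X'`. -/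
def push {X X' : C} (a : X ⟶ X') (Y : C) : ExtGroup E Y X →+ ExtGroup E Y X' :=
  ((E.obj (op Y)).map a).hom

/-- `c^* = E(c, X) : E(Y, X) → E(Y', X)` for `c : Y' ⟶ Y`. -/
def pull {Y' Y : C} (c : Y' ⟶ Y) (X : C) : ExtGroup E Y X →+ ExtGroup E Y' X :=
  ((E.map c.op).app X).hom

variable {E} in
/-- The sum `d ⊕ d' ∈ E(Y ⊞ Y', X ⊞ X')` of two extensions. -/
def extSum [Preadditive C] [HasBinaryBiproducts C] {X Y X' Y' : C}
    (d : ExtGroup E Y X) (d' : ExtGroup E Y' X') : ExtGroup E (Y ⊞ Y') (X ⊞ X') :=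
  push E biprod.inl _ (pull E biprod.fst _ d) + push E biprod.inr _ (pull E biprod.snd _ d')

end ExtGroups

/-! ### Extriangulated categories -/

/-- The structure of an extriangulated category on an additive category `C`, in the sense of
Nakaoka and Palu. The correspondence `s`, which sends `d ∈ E(Y, X)` to an equivalence class
of sequences `X ⟶ W ⟶ Y`, is given as the relation `IsExtriangle f g d`, that is
`s(d) = [X --f--> W --g--> Y]`; the fields `exists_realization`, `realization_unique` and
`realization_iso` say that the sequences related to a given `d` form exactly one
equivalence class. -/
structure ExtriangulatedStructure (C : Type u) [Category.{v} C] [Preadditive C]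
    [HasZeroObject C] [HasBinaryBiproducts C] where
  /-- the bifunctor of extensions, `(E.obj (op Y)).obj X` being `E(Y, X)` -/
  E : Cᵒᵖ ⥤ C ⥤ AddCommGrpCat.{w}
  additive_right (Y : Cᵒᵖ) : (E.obj Y).Additive
  additive_left (X : C) : (E.flip.obj X).Additive
  /-- `X --f--> W --g--> Y --d-->` is an extriangle -/
  IsExtriangle {X W Y : C} (f : X ⟶ W) (g : W ⟶ Y) (d : ExtGroup E Y X) : Prop
  exists_realization {X Y : C} (d : ExtGroup E Y X) :
    ∃ (W : C) (f : X ⟶ W) (g : W ⟶ Y), IsExtriangle f g d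
  realization_unique {X W W' Y : C} {f : X ⟶ W} {g : W ⟶ Y} {f' : X ⟶ W'} {g' : W' ⟶ Y}
    {d : ExtGroup E Y X} : IsExtriangle f g d → IsExtriangle f' g' d →
    ∃ i : W ≅ W', f ≫ i.hom = f' ∧ i.hom ≫ g' = g
  realization_iso {X W W' Y : C} {f : X ⟶ W} {g : W ⟶ Y} {d : ExtGroup E Y X} (i : W ≅ W') :
    IsExtriangle f g d → IsExtriangle (f ≫ i.hom) (i.inv ≫ g) d
  /-- a morphism of extensions is realized by a morphism of sequences -/
  realize_morphism {X W Y X' W' Y' : C} {f : X ⟶ W} {g : W ⟶ Y} {d : ExtGroup E Y X}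
    {f' : X' ⟶ W'} {g' : W' ⟶ Y'} {d' : ExtGroup E Y' X'} (a : X ⟶ X') (c : Y ⟶ Y') :
    IsExtriangle f g d → IsExtriangle f' g' d' → push E a _ d = pull E c _ d' →
    ∃ b : W ⟶ W', f ≫ b = a ≫ f' ∧ g ≫ c = b ≫ g'
  realize_zero (X Y : C) :
    IsExtriangle (biprod.inl : X ⟶ X ⊞ Y) (biprod.snd : X ⊞ Y ⟶ Y) (0 : ExtGroup E Y X)
  realize_sum {X W Y X' W' Y' : C} {f : X ⟶ W} {g : W ⟶ Y} {d : ExtGroup E Y X}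
    {f' : X' ⟶ W'} {g' : W' ⟶ Y'} {d' : ExtGroup E Y' X'} :
    IsExtriangle f g d → IsExtriangle f' g' d' →
    IsExtriangle (biprod.map f f') (biprod.map g g') (extSum d d')
  /-- the axiom (ET3) -/
  et3 {X W Y X' W' Y' : C} {f : X ⟶ W} {g : W ⟶ Y} {d : ExtGroup E Y X}
    {f' : X' ⟶ W'} {g' : W' ⟶ Y'} {d' : ExtGroup E Y' X'} (a : X ⟶ X') (b : W ⟶ W') :
    IsExtriangle f g d → IsExtriangle f' g' d' → f ≫ b = a ≫ f' →
    ∃ c : Y ⟶ Y', g ≫ c = b ≫ g' ∧ push E a _ d = pull E c _ d'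
  /-- the axiom (ET3)ᵒᵖ -/
  et3_op {X W Y X' W' Y' : C} {f : X ⟶ W} {g : W ⟶ Y} {d : ExtGroup E Y X}
    {f' : X' ⟶ W'} {g' : W' ⟶ Y'} {d' : ExtGroup E Y' X'} (b : W ⟶ W') (c : Y ⟶ Y') :
    IsExtriangle f g d → IsExtriangle f' g' d' → g ≫ c = b ≫ g' →
    ∃ a : X ⟶ X', f ≫ b = a ≫ f' ∧ push E a _ d = pull E c _ d'
  /-- the axiom (ET4) -/
  et4 {A B D M F : C} {f : A ⟶ B} {f' : B ⟶ D} {d : ExtGroup E D A}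
    {g : B ⟶ M} {g' : M ⟶ F} {d' : ExtGroup E F B} :
    IsExtriangle f f' d → IsExtriangle g g' d' →
    ∃ (N : C) (h' : M ⟶ N) (p : D ⟶ N) (q : N ⟶ F) (d'' : ExtGroup E N A),
      IsExtriangle (f ≫ g) h' d'' ∧ f' ≫ p = g ≫ h' ∧ h' ≫ q = g' ∧
      IsExtriangle p q (push E f' _ d') ∧ pull E p _ d'' = d ∧ push E f _ d'' = pull E q _ d'
  /-- the axiom (ET4)ᵒᵖ -/
  et4_op {D A B M F : C} {f' : D ⟶ A} {f : A ⟶ B} {d : ExtGroup E B D}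
    {g' : F ⟶ B} {g : B ⟶ M} {d' : ExtGroup E M F} :
    IsExtriangle f' f d → IsExtriangle g' g d' →
    ∃ (N : C) (h' : N ⟶ A) (p : D ⟶ N) (q : N ⟶ F) (d'' : ExtGroup E M N),
      IsExtriangle h' (f ≫ g) d'' ∧ p ≫ h' = f' ∧ q ≫ g' = h' ≫ f ∧
      IsExtriangle p q (pull E g' _ d) ∧ push E q _ d'' = d' ∧ push E p _ d = pull E g _ d''

/-! ### The second extension groups and the cup product -/

section SecondExtension

variable {C : Type u} [Category.{v} C] (E : Cᵒᵖ ⥤ C ⥤ AddCommGrpCat.{w})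

open scoped Classical in
/-- The second extension group `E²(Y, X)`: the coend `∫^W E(W, X) ⊗ E(Y, W)`, that is the
quotient of `⨁_W E(W, X) ⊗ E(Y, W)` by the subgroup generated by the differences
`f^* d ⊗ e - d ⊗ f_* e`. (The sum is over all objects; no smallness is needed as the group may
live in a larger universe.) -/
def Ext₂ (Y X : C) : Type max u w :=
  (DirectSum C fun W => ExtGroup E W X ⊗[ℤ] ExtGroup E Y W) ⧸
    AddSubgroup.closure {r | ∃ (W W' : C) (f : W ⟶ W') (d : ExtGroup E W' X)
      (e : ExtGroup E Y W),
      r = DirectSum.of (fun W => ExtGroup E W X ⊗[ℤ] ExtGroup E Y W) W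
            (pull E f X d ⊗ₜ[ℤ] e) -
          DirectSum.of (fun W => ExtGroup E W X ⊗[ℤ] ExtGroup E Y W) W'
            (d ⊗ₜ[ℤ] push E f Y e)}

instance (Y X : C) : AddCommGroup (Ext₂ E Y X) := by
  unfold Ext₂; infer_instance

variable {E}

open scoped Classical in
/-- The cup product `E(Y, X) × E(Z, Y) → E²(Z, X)`. -/
def cup {X Y Z : C} (d : ExtGroup E Y X) (e : ExtGroup E Z Y) : Ext₂ E Z X :=
  QuotientAddGroup.mk
    (DirectSum.of (fun W => ExtGroup E W X ⊗[ℤ] ExtGroup E Z W) Y (d ⊗ₜ[ℤ] e))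

end SecondExtension

/-! ### Extriangulated and biextriangulated functors -/

section Functors

variable {A : Type u₁} [Category.{v₁} A] [Preadditive A] [HasZeroObject A] [HasBinaryBiproducts A]
  {B : Type u₂} [Category.{v₂} B] [Preadditive B] [HasZeroObject B] [HasBinaryBiproducts B]
  {C : Type u₃} [Category.{v₃} C] [Preadditive C] [HasZeroObject C] [HasBinaryBiproducts C]

/-- A natural transformation `β : E(-, -) ⟹ E'(F(-), F(-))` of bifunctors to abelian groups. -/
@[ext]
structure ExtTrans (a : ExtriangulatedStructure.{w₁} A) (b : ExtriangulatedStructure.{w₂} B)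
    (F : A ⥤ B) where
  /-- the component `E(Y, X) → E'(F(Y), F(X))` -/
  app (Y X : A) : ExtGroup a.E Y X →+ ExtGroup b.E (F.obj Y) (F.obj X)
  app_push {X X' : A} (f : X ⟶ X') (Y : A) (d : ExtGroup a.E Y X) :
    app Y X' (push a.E f Y d) = push b.E (F.map f) (F.obj Y) (app Y X d)
  app_pull {Y' Y : A} (g : Y' ⟶ Y) (X : A) (d : ExtGroup a.E Y X) :
    app Y' X (pull a.E g X d) = pull b.E (F.map g) (F.obj X) (app Y X d)

/-- `(F, β)` is an extriangulated functor. -/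
structure IsExtriangulatedFunctor {a : ExtriangulatedStructure.{w₁} A}
    {b : ExtriangulatedStructure.{w₂} B} (F : A ⥤ B) (β : ExtTrans a b F) : Prop where
  additive : F.Additive
  map_extriangle {X W Y : A} (f : X ⟶ W) (g : W ⟶ Y) (d : ExtGroup a.E Y X) :
    a.IsExtriangle f g d → b.IsExtriangle (F.map f) (F.map g) (β.app Y X d)

/-- The data `(φ, ψ)` which make a functor `F` of two variables, `(F.obj X).obj Y` being
`F(X, Y)`, a biextriangulated functor `(F, φ, ψ)`. -/
@[ext]
structure BiextriangulatedStructure (a : ExtriangulatedStructure.{w₁} A)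
    (b : ExtriangulatedStructure.{w₂} B) (c : ExtriangulatedStructure.{w₃} C)
    (F : A ⥤ B ⥤ C) where
  /-- `φ^Y : E(-, -) ⟹ G(F(-, Y), F(-, Y))` -/
  φ (Y : B) : ExtTrans a c (F.flip.obj Y)
  /-- `ψ^X : E'(-, -) ⟹ G(F(X, -), F(X, -))` -/
  ψ (X : A) : ExtTrans b c (F.obj X)
  extriangulated_left (Y : B) : IsExtriangulatedFunctor (F.flip.obj Y) (φ Y)
  extriangulated_right (X : A) : IsExtriangulatedFunctor (F.obj X) (ψ X)
  extranatural_left (X X' : A) {Y Y' : B} (g : Y ⟶ Y') (d : ExtGroup a.E X' X) :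
    push c.E ((F.obj X).map g) ((F.obj X').obj Y) ((φ Y).app X' X d) =
      pull c.E ((F.obj X').map g) ((F.obj X).obj Y') ((φ Y').app X' X d)
  extranatural_right {X X' : A} (f : X ⟶ X') (Y Y' : B) (e : ExtGroup b.E Y' Y) :
    push c.E ((F.map f).app Y) ((F.obj X).obj Y') ((ψ X).app Y' Y e) =
      pull c.E ((F.map f).app Y') ((F.obj X').obj Y) ((ψ X').app Y' Y e)

/-- A biextriangulated functor `(F, φ, ψ)` is strong if
`ψ^{X'}(e) ⌣ φ^Y(d) = - (φ^{Y'}(d) ⌣ ψ^X(e))` in `G²(F(X, Y), F(X', Y'))` for all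
extensions `d ∈ E(X, X')` and `e ∈ E'(Y, Y')`. -/
def BiextriangulatedStructure.IsStrong {a : ExtriangulatedStructure.{w₁} A}
    {b : ExtriangulatedStructure.{w₂} B} {c : ExtriangulatedStructure.{w₃} C}
    {F : A ⥤ B ⥤ C} (P : BiextriangulatedStructure a b c F) : Prop :=
  ∀ (X X' : A) (Y Y' : B) (d : ExtGroup a.E X X') (e : ExtGroup b.E Y Y'),
    (cup (E := c.E) (X := (F.obj X').obj Y') (Y := (F.obj X').obj Y) (Z := (F.obj X).obj Y)
        ((P.ψ X').app Y Y' e) ((P.φ Y).app X X' d)) =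
      -(cup (E := c.E) (X := (F.obj X').obj Y') (Y := (F.obj X).obj Y') (Z := (F.obj X).obj Y)
        ((P.φ Y').app X X' d) ((P.ψ X).app Y Y' e))

end Functors

/-! ### Triangulated categories as extriangulated categories -/

section HomShift

variable (C : Type u) [Category.{v} C] [Preadditive C] [HasShift C ℤ]

/-- The bifunctor `E(Y, X) = Hom(Y, ΣX)`. -/
def homShift : Cᵒᵖ ⥤ C ⥤ AddCommGrpCat.{v} :=
  preadditiveCoyoneda ⋙ (Functor.whiskeringLeft C C AddCommGrpCat.{v}).obj
    (shiftFunctor C (1 : ℤ))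

variable {C}

/-- A morphism `Y ⟶ ΣX` as an extension. -/
def toExt {Y X : C} (d : Y ⟶ X⟦(1 : ℤ)⟧) : ExtGroup (homShift C) Y X := d

/-- An extension as a morphism `Y ⟶ ΣX`. -/
def ofExt {Y X : C} (d : ExtGroup (homShift C) Y X) : Y ⟶ X⟦(1 : ℤ)⟧ := d

lemma ofExt_inj {Y X : C} {d e : ExtGroup (homShift C) Y X} (h : ofExt d = ofExt e) : d = e := h

lemma ofExt_zero {Y X : C} : ofExt (0 : ExtGroup (homShift C) Y X) = 0 := rfl

lemma ofExt_add {Y X : C} (d e : ExtGroup (homShift C) Y X) :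
    ofExt (d + e) = ofExt d + ofExt e := rfl

lemma ofExt_push {X X' : C} (a : X ⟶ X') (Y : C) (d : ExtGroup (homShift C) Y X) :
    ofExt (push (homShift C) a Y d) = ofExt d ≫ a⟦(1 : ℤ)⟧' := rfl

lemma ofExt_pull {Y' Y : C} (c : Y' ⟶ Y) (X : C) (d : ExtGroup (homShift C) Y X) :
    ofExt (pull (homShift C) c X d) = c ≫ ofExt d := rfl

end HomShift

section Triangulated

variable {C : Type u} [Category.{v} C] [Preadditive C] [HasZeroObject C] [HasShift C ℤ]
  [∀ n : ℤ, (shiftFunctor C n).Additive] [Pretriangulated C]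

lemma ofExt_extSum {X Y X' Y' : C} (d : ExtGroup (homShift C) Y X)
    (d' : ExtGroup (homShift C) Y' X') :
    ofExt (extSum d d') = biprod.fst ≫ ofExt d ≫ (biprod.inl : X ⟶ X ⊞ X')⟦(1 : ℤ)⟧' +
      biprod.snd ≫ ofExt d' ≫ (biprod.inr : X' ⟶ X ⊞ X')⟦(1 : ℤ)⟧' := by
  rw [extSum, ofExt_add, ofExt_push, ofExt_push, ofExt_pull, ofExt_pull,
    Category.assoc, Category.assoc]

/-- The direct sum of two distinguished triangles is distinguished. -/
lemma sum_distinguished {X W Y X' W' Y' : C} {f : X ⟶ W} {g : W ⟶ Y} {h : Y ⟶ X⟦(1 : ℤ)⟧}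
    {f' : X' ⟶ W'} {g' : W' ⟶ Y'} {h' : Y' ⟶ X'⟦(1 : ℤ)⟧}
    (hT : Triangle.mk f g h ∈ distTriang C) (hT' : Triangle.mk f' g' h' ∈ distTriang C) :
    Triangle.mk (biprod.map f f') (biprod.map g g')
      (biprod.fst ≫ h ≫ (biprod.inl : X ⟶ X ⊞ X')⟦(1 : ℤ)⟧' +
        biprod.snd ≫ h' ≫ (biprod.inr : X' ⟶ X ⊞ X')⟦(1 : ℤ)⟧') ∈ distTriang C := by
  let k : Y ⊞ Y' ⟶ (X ⊞ X')⟦(1 : ℤ)⟧ :=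
    biprod.fst ≫ h ≫ (biprod.inl : X ⟶ X ⊞ X')⟦(1 : ℤ)⟧' +
      biprod.snd ≫ h' ≫ (biprod.inr : X' ⟶ X ⊞ X')⟦(1 : ℤ)⟧'
  have k₁ : k ≫ (biprod.fst : X ⊞ X' ⟶ X)⟦(1 : ℤ)⟧' = biprod.fst ≫ h := by
    simp [k, ← Functor.map_comp]
  have k₂ : k ≫ (biprod.snd : X ⊞ X' ⟶ X')⟦(1 : ℤ)⟧' = biprod.snd ≫ h' := by
    simp [k, ← Functor.map_comp]
  let D : WalkingPair → Triangle C :=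
    fun j => WalkingPair.casesOn j (Triangle.mk f g h) (Triangle.mk f' g' h')
  have hD : ∀ j, D j ∈ distTriang C := by rintro (_ | _) <;> assumption
  let p : ∀ j, Triangle.mk (biprod.map f f') (biprod.map g g') k ⟶ D j := fun j => match j with
    | WalkingPair.left =>
      { hom₁ := (biprod.fst : X ⊞ X' ⟶ X)
        hom₂ := (biprod.fst : W ⊞ W' ⟶ W)
        hom₃ := (biprod.fst : Y ⊞ Y' ⟶ Y)
        comm₁ := biprod.map_fst f f'
        comm₂ := biprod.map_fst g g'
        comm₃ := k₁ }
    | WalkingPair.right =>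
      { hom₁ := (biprod.snd : X ⊞ X' ⟶ X')
        hom₂ := (biprod.snd : W ⊞ W' ⟶ W')
        hom₃ := (biprod.snd : Y ⊞ Y' ⟶ Y')
        comm₁ := biprod.map_snd f f'
        comm₂ := biprod.map_snd g g'
        comm₃ := k₂ }
  have key : ∀ (f : WalkingPair → C) (q : ∀ j, f .left ⊞ f .right ⟶ f j),
      q .left = biprod.fst → q .right = biprod.snd → IsIso (Pi.lift q) := by
    intro f q h₁ h₂
    refine ⟨biprod.lift (Pi.π f .left) (Pi.π f .right), ?_, ?_⟩
    · ext <;> simp [h₁, h₂]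
    · refine Pi.hom_ext _ _ ?_
      rintro (_ | _) <;> simp [h₁, h₂]
  have h₁ : IsIso (productTriangle.lift D p).hom₁ := key (fun j => (D j).obj₁) _ rfl rfl
  have h₂ : IsIso (productTriangle.lift D p).hom₂ := key (fun j => (D j).obj₂) _ rfl rfl
  have h₃ : IsIso (productTriangle.lift D p).hom₃ := key (fun j => (D j).obj₃) _ rfl rfl
  have : IsIso (productTriangle.lift D p) := Triangle.isIso_of_isIsos _ h₁ h₂ h₃
  exact isomorphic_distinguished _ (productTriangle_distinguished D hD) _
    (asIso (productTriangle.lift D p))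

/-- An isomorphism in the middle term preserves distinguished triangles. -/
lemma distinguished_of_iso₂ {X W W' Y : C} {f : X ⟶ W} {g : W ⟶ Y} {h : Y ⟶ X⟦(1 : ℤ)⟧}
    (i : W ≅ W') (hT : Triangle.mk f g h ∈ distTriang C) :
    Triangle.mk (f ≫ i.hom) (i.inv ≫ g) h ∈ distTriang C := by
  refine isomorphic_distinguished _ hT _
    (Triangle.isoMk _ _ (Iso.refl X) i.symm (Iso.refl Y) ?_ ?_ ?_)
  · change (f ≫ i.hom) ≫ i.inv = 𝟙 X ≫ f
    simp
  · change (i.inv ≫ g) ≫ 𝟙 Y = i.inv ≫ g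
    simp
  · change h ≫ (𝟙 X)⟦(1 : ℤ)⟧' = 𝟙 Y ≫ h
    simp

/-- Two distinguished triangles with the same third morphism have isomorphic middle terms. -/
lemma exists_iso₂ {X W W' Y : C} {f : X ⟶ W} {g : W ⟶ Y} {f' : X ⟶ W'} {g' : W' ⟶ Y}
    {h : Y ⟶ X⟦(1 : ℤ)⟧} (hT : Triangle.mk f g h ∈ distTriang C)
    (hT' : Triangle.mk f' g' h ∈ distTriang C) :
    ∃ i : W ≅ W', f ≫ i.hom = f' ∧ i.hom ≫ g' = g := by
  have hh : h ≫ (𝟙 X)⟦(1 : ℤ)⟧' = 𝟙 Y ≫ h := by simp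
  obtain ⟨b, hb₁, hb₂⟩ := complete_distinguished_triangle_morphism₂ _ _ hT hT' (𝟙 X) (𝟙 Y) hh
  have hi : IsIso b := isIso₂_of_isIso₁₃ (T := Triangle.mk f g h) (T' := Triangle.mk f' g' h)
    { hom₁ := 𝟙 X, hom₂ := b, hom₃ := 𝟙 Y, comm₁ := hb₁, comm₂ := hb₂, comm₃ := hh }
    hT hT' (inferInstanceAs (IsIso (𝟙 X))) (inferInstanceAs (IsIso (𝟙 Y)))
  exact ⟨@asIso _ _ W W' b hi, hb₁.trans (Category.id_comp f'), hb₂.symm.trans (Category.comp_id g)⟩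

/-- The dual form of the octahedral axiom. -/
lemma octahedron_op [IsTriangulated C] {D A B M F : C} {f' : D ⟶ A} {f : A ⟶ B}
    {d : B ⟶ D⟦(1 : ℤ)⟧} {g' : F ⟶ B} {g : B ⟶ M} {d' : M ⟶ F⟦(1 : ℤ)⟧}
    (h₁ : Triangle.mk f' f d ∈ distTriang C) (h₂ : Triangle.mk g' g d' ∈ distTriang C) :
    ∃ (N : C) (h' : N ⟶ A) (p : D ⟶ N) (q : N ⟶ F) (d'' : M ⟶ N⟦(1 : ℤ)⟧),
      Triangle.mk h' (f ≫ g) d'' ∈ distTriang C ∧ p ≫ h' = f' ∧ q ≫ g' = h' ≫ f ∧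
      Triangle.mk p q (g' ≫ d) ∈ distTriang C ∧ d'' ≫ q⟦(1 : ℤ)⟧' = d' ∧
      d ≫ p⟦(1 : ℤ)⟧' = g ≫ d'' := by
  obtain ⟨N, p, q, h₃⟩ := distinguished_cocone_triangle₂ (g' ≫ d)
  have o := Triangulated.someOctahedron (u₁₂ := g') (u₂₃ := d) rfl h₂
    (rot_of_distTriang _ (rot_of_distTriang _ h₁)) (rot_of_distTriang _ (rot_of_distTriang _ h₃))
  obtain ⟨m₁, m₃, c₁, c₂, c₃, c₄, c₅⟩ : ∃ (m₁ : M ⟶ N⟦(1 : ℤ)⟧) (m₃ : N⟦(1 : ℤ)⟧ ⟶ A⟦(1 : ℤ)⟧),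
      g ≫ m₁ = d ≫ (-p⟦(1 : ℤ)⟧') ∧ m₁ ≫ (-q⟦(1 : ℤ)⟧') = d' ∧
      (-p⟦(1 : ℤ)⟧') ≫ m₃ = -f'⟦(1 : ℤ)⟧' ∧
      (-q⟦(1 : ℤ)⟧') ≫ g'⟦(1 : ℤ)⟧' = m₃ ≫ (-f⟦(1 : ℤ)⟧') ∧
      Triangle.mk m₁ m₃ ((-f⟦(1 : ℤ)⟧') ≫ g⟦(1 : ℤ)⟧') ∈ distTriang C :=
    ⟨o.m₁, o.m₃, o.comm₁, o.comm₂, o.comm₃, o.comm₄, o.mem⟩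
  obtain ⟨h', rfl⟩ := (shiftFunctor C (1 : ℤ)).map_surjective m₃
  refine ⟨N, h', p, q, -m₁, ?_, ?_, ?_, h₃, ?_, ?_⟩
  · rw [Pretriangulated.rotate_distinguished_triangle, Pretriangulated.rotate_distinguished_triangle]
    refine isomorphic_distinguished _ c₅ _ (Triangle.isoMk _ _ (Iso.refl M)
      (-(Iso.refl (N⟦(1 : ℤ)⟧))) (Iso.refl (A⟦(1 : ℤ)⟧)) ?_ ?_ ?_)
    · change (-m₁) ≫ (-𝟙 (N⟦(1 : ℤ)⟧)) = 𝟙 M ≫ m₁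
      simp
    · change (-h'⟦(1 : ℤ)⟧') ≫ 𝟙 (A⟦(1 : ℤ)⟧) = (-𝟙 (N⟦(1 : ℤ)⟧)) ≫ h'⟦(1 : ℤ)⟧'
      simp
    · change (-(f ≫ g)⟦(1 : ℤ)⟧') ≫ (𝟙 M)⟦(1 : ℤ)⟧' =
        𝟙 (A⟦(1 : ℤ)⟧) ≫ (-f⟦(1 : ℤ)⟧') ≫ g⟦(1 : ℤ)⟧'
      simp
  · apply (shiftFunctor C (1 : ℤ)).map_injective
    simpa using c₃
  · apply (shiftFunctor C (1 : ℤ)).map_injective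
    simpa using c₄
  · simpa using c₂
  · rw [Preadditive.comp_neg, c₁, Preadditive.comp_neg, neg_neg]

variable (C)

/-- A triangulated category as an extriangulated category: `E(Y, X) = Hom(Y, ΣX)`, and
`X --f--> W --g--> Y --d-->` is an extriangle if `X --f--> W --g--> Y --d--> ΣX` is an exact
triangle. -/
def triangulatedStructure [IsTriangulated C] : ExtriangulatedStructure.{v} C where
  E := homShift C
  additive_right Y := by unfold homShift; dsimp; infer_instance
  additive_left X := ⟨fun {Y Y'} f g => by
    apply AddCommGrpCat.hom_ext
    ext d
    exact Preadditive.add_comp _ _ _ _ _ _⟩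
  IsExtriangle f g d := Triangle.mk f g (ofExt d) ∈ distTriang C
  exists_realization d := distinguished_cocone_triangle₂ (ofExt d)
  realization_unique h h' := exists_iso₂ h h'
  realization_iso i h := distinguished_of_iso₂ i h
  realize_morphism a c h h' hac := complete_distinguished_triangle_morphism₂ _ _ h h' a c hac
  realize_zero X Y := binaryBiproductTriangle_distinguished X Y
  realize_sum {X W Y X' W' Y' f g d f' g' d'} h h' := by
    rw [ofExt_extSum]
    exact sum_distinguished h h'
  et3 a b h h' hab := complete_distinguished_triangle_morphism _ _ h h' a b hab
  et3_op b c h h' hbc := complete_distinguished_triangle_morphism₁ _ _ h h' b c hbc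
  et4 {A B D M F f f' d g g' d'} h h' := by
    obtain ⟨N, h'', d'', h₃⟩ := distinguished_cocone_triangle (f ≫ g)
    have o := Triangulated.someOctahedron rfl h h' h₃
    exact ⟨N, h'', o.m₁, o.m₃, d'', h₃, o.comm₁, o.comm₃, o.mem, o.comm₂, o.comm₄⟩
  et4_op h h' := octahedron_op h h'

end Triangulated

/-! ### Triangulated and bitriangulated functors -/

section BitriangulatedFunctors

variable {S : Type u₁} [Category.{v₁} S] [Preadditive S] [HasZeroObject S] [HasShift S ℤ]
  [∀ n : ℤ, (shiftFunctor S n).Additive] [Pretriangulated S]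
  {T : Type u₂} [Category.{v₂} T] [Preadditive T] [HasZeroObject T] [HasShift T ℤ]
  [∀ n : ℤ, (shiftFunctor T n).Additive] [Pretriangulated T]
  {U : Type u₃} [Category.{v₃} U] [Preadditive U] [HasZeroObject U] [HasShift U ℤ]
  [∀ n : ℤ, (shiftFunctor U n).Additive] [Pretriangulated U]

/-- `(H, τ)` is a triangulated functor, for a natural transformation `τ : H(Σ-) ⟶ ΣH(-)`.
(It follows that `τ` is an isomorphism and that `H` is additive.) -/
def IsTriangulatedFunctor (H : S ⥤ T)
    (τ : shiftFunctor S (1 : ℤ) ⋙ H ⟶ H ⋙ shiftFunctor T (1 : ℤ)) : Prop :=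
  ∀ {X W Y : S} (f : X ⟶ W) (g : W ⟶ Y) (h : Y ⟶ X⟦(1 : ℤ)⟧),
    Triangle.mk f g h ∈ distTriang S →
      Triangle.mk (H.map f) (H.map g) (H.map h ≫ τ.app X) ∈ distTriang T

/-- The data `(θ, ζ)` which make a functor `F` of two variables, `(F.obj X).obj Y` being
`F(X, Y)`, a bitriangulated functor `(F, θ, ζ)`. -/
@[ext]
structure BitriangulatedStructure (F : S ⥤ T ⥤ U) where
  /-- `θ : F(Σ-, -) ⟶ ΣF(-, -)` -/
  θ : shiftFunctor S (1 : ℤ) ⋙ F ⟶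
    F ⋙ (Functor.whiskeringRight T U U).obj (shiftFunctor U (1 : ℤ))
  /-- `ζ : F(-, Σ-) ⟶ ΣF(-, -)` -/
  ζ : F ⋙ (Functor.whiskeringLeft T T U).obj (shiftFunctor T (1 : ℤ)) ⟶
    F ⋙ (Functor.whiskeringRight T U U).obj (shiftFunctor U (1 : ℤ))
  triangulated_left (Y : T) : IsTriangulatedFunctor (F.flip.obj Y)
    { app := fun X => (θ.app X).app Y
      naturality := fun _ _ f => NatTrans.congr_app (θ.naturality f) Y }
  triangulated_right (X : S) : IsTriangulatedFunctor (F.obj X) (ζ.app X)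
  /-- `Σζ ∘ θ = - Σθ ∘ ζ` as morphisms `F(ΣX, ΣY) ⟶ ΣΣF(X, Y)` -/
  anticomm (X : S) (Y : T) :
    (θ.app X).app (Y⟦(1 : ℤ)⟧) ≫ ((ζ.app X).app Y)⟦(1 : ℤ)⟧' =
      -((ζ.app (X⟦(1 : ℤ)⟧)).app Y ≫ ((θ.app X).app Y)⟦(1 : ℤ)⟧')

end BitriangulatedFunctors

end Extriangulated

end

/-!
Everything reduces to two observations on `E(Y, X) = Hom(Y, ΣX)`.

* A Yoneda-type argument: every `f : X' ⟶ ΣX` is the extension `f^* id_{ΣX}`, so a natural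
  transformation `φ : E(-, -) ⟹ E'(H-, H-)` is the same as a natural transformation
  `τ : HΣ ⟶ ΣH`, via `τ_X = φ(id_{ΣX})` and `φ(f) = τ_X ∘ H f` (`ofExt_app_eq`). Under this
  correspondence extriangulated functors become triangulated functors; the only point that is not
  formal is that a triangulated functor is additive (`IsTriangulatedFunctor.additive`). For a
  functor of two variables, naturality of `θ` and `ζ` in the remaining variable corresponds to the
  extranaturality conditions.

* The second extension group is `Hom(Z, Σ²X)`, with `d ⌣ e` corresponding to `Σd ∘ e`. Indeed,
  `d ⊗ e ↦ Σd ∘ e` is well defined on the coend (`ext₂Eval`), and since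
  `d ⌣ e = d^* id ⌣ e = id ⌣ d_* e`, the class `d ⌣ e` depends only on `Σd ∘ e`
  (`cup_eq_cup_id`). Hence strongness is an equation of morphisms `F(X, Y) ⟶ Σ²F(X', Y')`
  (`cup_eq_neg_cup_iff`). For `d` and `e` identities it is the anticommutativity of `θ` and `ζ`,
  and the general case is the composite of that one with `F(d, e)`.
-/

noncomputable section

namespace Extriangulated

/-! ### The second extension group of a triangulated category -/

section Cup

open scoped Classical in
/-- Two representatives of a class in the coend: `c^* d ⌣ e = d ⌣ c_* e`. -/
lemma cup_pull {C : Type u} [Category.{v} C] {E : Cᵒᵖ ⥤ C ⥤ AddCommGrpCat.{w}}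
    {X W W' Z : C} (c : W ⟶ W') (d : ExtGroup E W' X) (e : ExtGroup E Z W) :
    cup (pull E c X d) e = cup d (push E c Z e) := by
  refine (QuotientAddGroup.eq_iff_sub_mem).2 (AddSubgroup.subset_closure ?_)
  exact ⟨W, W', c, d, e, rfl⟩

open scoped Classical in
lemma cup_neg {C : Type u} [Category.{v} C] {E : Cᵒᵖ ⥤ C ⥤ AddCommGrpCat.{w}}
    {X Y Z : C} (d : ExtGroup E Y X) (e : ExtGroup E Z Y) :
    cup d (-e) = -cup d e := by
  unfold cup
  rw [TensorProduct.tmul_neg, map_neg]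
  rfl

variable {C : Type u} [Category.{v} C] [Preadditive C] [HasShift C ℤ]

lemma toExt_eq_pull {Y X : C} (f : Y ⟶ X⟦(1 : ℤ)⟧) :
    toExt f = pull (homShift C) f X (toExt (𝟙 (X⟦(1 : ℤ)⟧))) :=
  ofExt_inj (Category.comp_id f).symm

/-- The class `d ⌣ e` depends only on the composite `Σd ∘ e`, so `ext₂Eval` below is injective on
cup products. -/
lemma cup_eq_cup_id {X Y Z : C} (d : ExtGroup (homShift C) Y X)
    (e : ExtGroup (homShift C) Z Y) :
    cup d e = cup (toExt (𝟙 (X⟦(1 : ℤ)⟧))) (toExt (ofExt e ≫ (ofExt d)⟦(1 : ℤ)⟧')) := by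
  have h : d = pull (homShift C) (ofExt d) X (toExt (𝟙 (X⟦(1 : ℤ)⟧))) := toExt_eq_pull d
  conv_lhs => rw [h, cup_pull]
  rfl

variable [∀ n : ℤ, (shiftFunctor C n).Additive]

/-- The composition `d ⊗ e ↦ Σd ∘ e`, before passing to the coend. -/
def tensorEval (Z W X : C) :
    ExtGroup (homShift C) W X ⊗[ℤ] ExtGroup (homShift C) Z W →+
      (Z ⟶ (X⟦(1 : ℤ)⟧)⟦(1 : ℤ)⟧) :=
  TensorProduct.liftAddHom
    (AddMonoidHom.mk' (fun d => AddMonoidHom.mk' (fun e => ofExt e ≫ (ofExt d)⟦(1 : ℤ)⟧')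
      (fun e e' => by rw [ofExt_add, Preadditive.add_comp]))
      (fun d d' => by
        ext e
        change _ ≫ (ofExt (d + d'))⟦(1 : ℤ)⟧' = _ ≫ _ + _ ≫ _
        rw [ofExt_add, Functor.map_add, Preadditive.comp_add]))
    (fun n d e => by
      simp only [map_zsmul, AddMonoidHom.smul_apply])

lemma tensorEval_tmul {Z W X : C} (d : ExtGroup (homShift C) W X)
    (e : ExtGroup (homShift C) Z W) :
    tensorEval Z W X (d ⊗ₜ[ℤ] e) = ofExt e ≫ (ofExt d)⟦(1 : ℤ)⟧' := rfl

open scoped Classical in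
/-- The map `Ext₂(Z, X) → Hom(Z, Σ²X)` which sends `d ⌣ e` to `Σd ∘ e`. -/
def ext₂Eval (Z X : C) : Ext₂ (homShift C) Z X →+ (Z ⟶ (X⟦(1 : ℤ)⟧)⟦(1 : ℤ)⟧) :=
  QuotientAddGroup.lift _ (DirectSum.toAddMonoid fun W => tensorEval Z W X) <| by
    rw [AddSubgroup.closure_le]
    rintro _ ⟨W, W', f, d, e, rfl⟩
    rw [SetLike.mem_coe, AddMonoidHom.mem_ker, map_sub, DirectSum.toAddMonoid_of,
      DirectSum.toAddMonoid_of, tensorEval_tmul, tensorEval_tmul, ofExt_pull, ofExt_push,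
      Functor.map_comp, Category.assoc, sub_self]

open scoped Classical in
lemma ext₂Eval_cup {X Y Z : C} (d : ExtGroup (homShift C) Y X)
    (e : ExtGroup (homShift C) Z Y) :
    ext₂Eval Z X (cup d e) = ofExt e ≫ (ofExt d)⟦(1 : ℤ)⟧' := by
  change DirectSum.toAddMonoid (fun W => tensorEval Z W X) (DirectSum.of _ Y _) = _
  rw [DirectSum.toAddMonoid_of, tensorEval_tmul]

lemma cup_eq_neg_cup_iff {X Y Y' Z : C} (d : ExtGroup (homShift C) Y X)
    (e : ExtGroup (homShift C) Z Y) (d' : ExtGroup (homShift C) Y' X)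
    (e' : ExtGroup (homShift C) Z Y') :
    cup d e = -cup d' e' ↔
      ofExt e ≫ (ofExt d)⟦(1 : ℤ)⟧' = -(ofExt e' ≫ (ofExt d')⟦(1 : ℤ)⟧') := by
  constructor
  · intro h
    rw [← ext₂Eval_cup, ← ext₂Eval_cup, h, map_neg]
  · intro h
    rw [cup_eq_cup_id d e, cup_eq_cup_id d' e', h, ← cup_neg]
    rfl

end Cup

/-! ### Triangulated functors are additive -/

section Additive

variable {S : Type u₁} [Category.{v₁} S] [Preadditive S] [HasZeroObject S] [HasShift S ℤ]
  [∀ n : ℤ, (shiftFunctor S n).Additive] [Pretriangulated S]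
  {T : Type u₂} [Category.{v₂} T] [Preadditive T] [HasZeroObject T] [HasShift T ℤ]
  [∀ n : ℤ, (shiftFunctor T n).Additive] [Pretriangulated T]
  {H : S ⥤ T} {τ : shiftFunctor S (1 : ℤ) ⋙ H ⟶ H ⋙ shiftFunctor T (1 : ℤ)}

open scoped ZeroObject in
lemma IsTriangulatedFunctor.map_zero (hH : IsTriangulatedFunctor H τ) (X Y : S) :
    H.map (0 : X ⟶ Y) = 0 := by
  -- consecutive morphisms in the image of the triangle `0 ⟶ 0 ⟶ 0 ⟶ Σ0` compose to zero, hence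
  -- `H` kills the zero morphism of the zero object
  have h := comp_distTriang_mor_zero₁₂ _
    (hH (𝟙 (0 : S)) (0 : (0 : S) ⟶ 0) 0 (contractible_distinguished (0 : S)))
  change H.map (𝟙 (0 : S)) ≫ H.map (0 : (0 : S) ⟶ 0) = 0 at h
  rw [← H.map_comp, Category.id_comp] at h
  have e : (0 : X ⟶ Y) = (0 : X ⟶ (0 : S)) ≫ (0 : (0 : S) ⟶ 0) ≫ (0 : (0 : S) ⟶ Y) := by simp
  rw [e, H.map_comp, H.map_comp, h, zero_comp, comp_zero]

/-- A triangulated functor preserves biproducts, because the image of the split triangle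
`X ⟶ X ⊞ Y ⟶ Y` is exact. -/
lemma IsTriangulatedFunctor.map_biprod_total (hH : IsTriangulatedFunctor H τ) (X Y : S) :
    H.map (biprod.fst : X ⊞ Y ⟶ X) ≫ H.map biprod.inl +
      H.map (biprod.snd : X ⊞ Y ⟶ Y) ≫ H.map biprod.inr = 𝟙 (H.obj (X ⊞ Y)) := by
  have hT := hH _ _ _ (binaryBiproductTriangle_distinguished X Y)
  have h₁₁ : H.map (biprod.inl : X ⟶ X ⊞ Y) ≫ H.map biprod.fst = 𝟙 _ := by
    rw [← H.map_comp, biprod.inl_fst, H.map_id]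
  have h₁₂ : H.map (biprod.inl : X ⟶ X ⊞ Y) ≫ H.map biprod.snd = 0 := by
    rw [← H.map_comp, biprod.inl_snd, hH.map_zero]
  have h₂₁ : H.map (biprod.inr : Y ⟶ X ⊞ Y) ≫ H.map biprod.fst = 0 := by
    rw [← H.map_comp, biprod.inr_fst, hH.map_zero]
  have h₂₂ : H.map (biprod.inr : Y ⟶ X ⊞ Y) ≫ H.map biprod.snd = 𝟙 _ := by
    rw [← H.map_comp, biprod.inr_snd, H.map_id]
  rw [← sub_eq_zero]
  -- the difference `k` of the two sides factors as `m ≫ H(inl)`, and `m = k ≫ H(fst) = 0`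
  set k := H.map (biprod.fst : X ⊞ Y ⟶ X) ≫ H.map biprod.inl +
    H.map (biprod.snd : X ⊞ Y ⟶ Y) ≫ H.map biprod.inr - 𝟙 (H.obj (X ⊞ Y)) with hk
  have k₁ : k ≫ H.map biprod.fst = 0 := by
    simp [hk, Preadditive.sub_comp, Preadditive.add_comp, h₁₁, h₂₁]
  have k₂ : k ≫ H.map biprod.snd = 0 := by
    simp [hk, Preadditive.sub_comp, Preadditive.add_comp, h₁₂, h₂₂]
  obtain ⟨m, hm⟩ : ∃ m : H.obj (X ⊞ Y) ⟶ H.obj X, k = m ≫ H.map biprod.inl :=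
    Triangle.coyoneda_exact₂ _ hT k k₂
  have hm₀ : m = 0 := by
    rw [← Category.comp_id m, ← h₁₁, ← Category.assoc, ← hm, k₁]
  rw [hm, hm₀, zero_comp]

lemma IsTriangulatedFunctor.additive (hH : IsTriangulatedFunctor H τ) : H.Additive where
  map_add {X Y f g} := by
    have e : f + g = biprod.lift f g ≫ biprod.desc (𝟙 Y) (𝟙 Y) := by simp
    rw [e, H.map_comp, ← Category.id_comp (H.map (biprod.desc _ _)), ← hH.map_biprod_total]
    simp only [Preadditive.add_comp, Preadditive.comp_add, ← H.map_comp, Category.assoc,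
      biprod.inl_desc, biprod.inr_desc, biprod.lift_fst, biprod.lift_snd, Category.comp_id]

end Additive

/-! ### Transformations of extension groups and of suspended functors -/

section Trans

variable {S : Type u₁} [Category.{v₁} S] [Preadditive S] [HasZeroObject S] [HasShift S ℤ]
  [∀ n : ℤ, (shiftFunctor S n).Additive] [Pretriangulated S] [IsTriangulated S]
  {T : Type u₂} [Category.{v₂} T] [Preadditive T] [HasZeroObject T] [HasShift T ℤ]
  [∀ n : ℤ, (shiftFunctor T n).Additive] [Pretriangulated T] [IsTriangulated T]
  {H : S ⥤ T}

/-- The component `φ_{ΣX, X}(id_{ΣX}) : H(ΣX) ⟶ ΣH(X)`. -/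
def suspComponent (β : ExtTrans (triangulatedStructure S) (triangulatedStructure T) H) (X : S) :
    H.obj (X⟦(1 : ℤ)⟧) ⟶ (H.obj X)⟦(1 : ℤ)⟧ :=
  ofExt (β.app (X⟦(1 : ℤ)⟧) X (toExt (𝟙 (X⟦(1 : ℤ)⟧))))

lemma ofExt_app_eq (β : ExtTrans (triangulatedStructure S) (triangulatedStructure T) H)
    {X' X : S} (f : X' ⟶ X⟦(1 : ℤ)⟧) :
    ofExt (β.app X' X (toExt f)) = H.map f ≫ suspComponent β X :=
  (congrArg (fun d => ofExt (β.app X' X d)) (toExt_eq_pull f)).trans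
    (congrArg ofExt (β.app_pull f X (toExt (𝟙 _))))

lemma map_shift_comp_suspComponent
    (β : ExtTrans (triangulatedStructure S) (triangulatedStructure T) H) {X Y : S} (f : X ⟶ Y) :
    H.map (f⟦(1 : ℤ)⟧') ≫ suspComponent β Y = suspComponent β X ≫ (H.map f)⟦(1 : ℤ)⟧' := by
  rw [← ofExt_app_eq]
  refine Eq.trans ?_ (congrArg ofExt (β.app_push f (X⟦(1 : ℤ)⟧) (toExt (𝟙 _))))
  exact congrArg (fun d => ofExt (β.app (X⟦(1 : ℤ)⟧) Y d))
    (ofExt_inj (Category.id_comp (f⟦(1 : ℤ)⟧')).symm)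

/-- A natural transformation `τ : HΣ ⟶ ΣH`, with `H` additive, as the transformation
`f ↦ τ_X ∘ H f` of extension groups. The category is given explicitly in `ofExt (C := S) d` because
`d` lives in the extension bifunctor of `triangulatedStructure S`, which is `homShift S` only after
unfolding. -/
def extTransOfShift (hH : H.Additive)
    (τ : shiftFunctor S (1 : ℤ) ⋙ H ⟶ H ⋙ shiftFunctor T (1 : ℤ)) :
    ExtTrans (triangulatedStructure S) (triangulatedStructure T) H where
  app Y X := AddMonoidHom.mk'
    (fun d : ExtGroup (homShift S) Y X => toExt (H.map (ofExt d) ≫ τ.app X))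
    (fun d e => by
      change H.map (ofExt (C := S) d + ofExt (C := S) e) ≫ τ.app X =
        H.map (ofExt (C := S) d) ≫ τ.app X + H.map (ofExt (C := S) e) ≫ τ.app X
      rw [H.map_add, Preadditive.add_comp])
  app_push {X X'} f Y d := by
    change H.map (ofExt (C := S) d ≫ f⟦(1 : ℤ)⟧') ≫ τ.app X' =
      (H.map (ofExt (C := S) d) ≫ τ.app X) ≫ (H.map f)⟦(1 : ℤ)⟧'
    rw [H.map_comp, Category.assoc, Category.assoc]
    exact congrArg (H.map (ofExt (C := S) d) ≫ ·) (τ.naturality f)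
  app_pull {Y' Y} g X d := by
    change H.map (g ≫ ofExt (C := S) d) ≫ τ.app X =
      H.map g ≫ H.map (ofExt (C := S) d) ≫ τ.app X
    rw [H.map_comp, Category.assoc]

lemma IsTriangulatedFunctor.isExtriangulatedFunctor
    {τ : shiftFunctor S (1 : ℤ) ⋙ H ⟶ H ⋙ shiftFunctor T (1 : ℤ)}
    (hH : IsTriangulatedFunctor H τ) :
    IsExtriangulatedFunctor H (extTransOfShift hH.additive τ) where
  additive := hH.additive
  map_extriangle f g d h := hH f g (ofExt d) h

lemma IsExtriangulatedFunctor.isTriangulatedFunctor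
    {β : ExtTrans (triangulatedStructure S) (triangulatedStructure T) H}
    (hβ : IsExtriangulatedFunctor H β)
    {τ : shiftFunctor S (1 : ℤ) ⋙ H ⟶ H ⋙ shiftFunctor T (1 : ℤ)}
    (hτ : ∀ X, τ.app X = suspComponent β X) :
    IsTriangulatedFunctor H τ := by
  intro X W Y f g h hT
  rw [hτ]
  have h' : Triangle.mk (H.map f) (H.map g) (ofExt (β.app Y X (toExt h))) ∈ distTriang T :=
    hβ.map_extriangle f g (toExt h) hT
  rwa [ofExt_app_eq] at h'

end Trans

/-! ### Biextriangulated and bitriangulated functors -/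

section Bi

variable {S : Type u₁} [Category.{v₁} S] [Preadditive S] [HasZeroObject S] [HasShift S ℤ]
  [∀ n : ℤ, (shiftFunctor S n).Additive] [Pretriangulated S] [IsTriangulated S]
  {T : Type u₂} [Category.{v₂} T] [Preadditive T] [HasZeroObject T] [HasShift T ℤ]
  [∀ n : ℤ, (shiftFunctor T n).Additive] [Pretriangulated T] [IsTriangulated T]
  {U : Type u₃} [Category.{v₃} U] [Preadditive U] [HasZeroObject U] [HasShift U ℤ]
  [∀ n : ℤ, (shiftFunctor U n).Additive] [Pretriangulated U] [IsTriangulated U]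
  {F : S ⥤ T ⥤ U}

/-- The bitriangulated structure `θ = φ(id)`, `ζ = ψ(id)` of a strong biextriangulated
functor. -/
def BiextriangulatedStructure.toBitriangulated
    (P : BiextriangulatedStructure (triangulatedStructure S) (triangulatedStructure T)
      (triangulatedStructure U) F) (hP : P.IsStrong) : BitriangulatedStructure F where
  θ :=
    { app := fun X =>
        { app := fun Y => suspComponent (P.φ Y) X
          naturality := fun _ _ g =>
            (congrArg ofExt (P.extranatural_left X (X⟦(1 : ℤ)⟧) g (toExt (𝟙 _)))).symm }
      naturality := fun _ _ f => by
        ext Y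
        exact map_shift_comp_suspComponent (P.φ Y) f }
  ζ :=
    { app := fun X =>
        { app := fun Y => suspComponent (P.ψ X) Y
          naturality := fun _ _ g => map_shift_comp_suspComponent (P.ψ X) g }
      naturality := fun _ _ f => by
        ext Y
        exact (congrArg ofExt
          (P.extranatural_right f Y (Y⟦(1 : ℤ)⟧) (toExt (𝟙 _)))).symm }
  triangulated_left Y := (P.extriangulated_left Y).isTriangulatedFunctor fun _ => rfl
  triangulated_right X := (P.extriangulated_right X).isTriangulatedFunctor fun _ => rfl
  anticomm X Y := (cup_eq_neg_cup_iff _ _ _ _).1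
    (hP (X⟦(1 : ℤ)⟧) X (Y⟦(1 : ℤ)⟧) Y (toExt (𝟙 _)) (toExt (𝟙 _)))

/-- The biextriangulated structure `φ(f) = θ ∘ F(f, Y)`, `ψ(g) = ζ ∘ F(X, g)` of a
bitriangulated functor. -/
def BitriangulatedStructure.toBiextriangulated (Q : BitriangulatedStructure F) :
    BiextriangulatedStructure (triangulatedStructure S) (triangulatedStructure T)
      (triangulatedStructure U) F where
  φ Y := extTransOfShift (IsTriangulatedFunctor.additive (Q.triangulated_left Y)) _
  ψ X := extTransOfShift (IsTriangulatedFunctor.additive (Q.triangulated_right X)) _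
  extriangulated_left Y := IsTriangulatedFunctor.isExtriangulatedFunctor (Q.triangulated_left Y)
  extriangulated_right X := IsTriangulatedFunctor.isExtriangulatedFunctor (Q.triangulated_right X)
  extranatural_left X X' {Y Y'} g d := by
    change ((F.map (ofExt (C := S) d)).app Y ≫ (Q.θ.app X).app Y) ≫
        ((F.obj X).map g)⟦(1 : ℤ)⟧' =
      (F.obj X').map g ≫ (F.map (ofExt (C := S) d)).app Y' ≫ (Q.θ.app X).app Y'
    rw [Category.assoc, NatTrans.naturality_assoc]
    exact congrArg ((F.map (ofExt (C := S) d)).app Y ≫ ·) ((Q.θ.app X).naturality g).symm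
  extranatural_right {X X'} f Y Y' e := by
    change ((F.obj X).map (ofExt (C := T) e) ≫ (Q.ζ.app X).app Y) ≫
        ((F.map f).app Y)⟦(1 : ℤ)⟧' =
      (F.map f).app Y' ≫ (F.obj X').map (ofExt (C := T) e) ≫ (Q.ζ.app X').app Y
    rw [Category.assoc, ← NatTrans.naturality_assoc]
    exact congrArg ((F.obj X).map (ofExt (C := T) e) ≫ ·)
      (NatTrans.congr_app (Q.ζ.naturality f) Y).symm

lemma BitriangulatedStructure.isStrong_toBiextriangulated (Q : BitriangulatedStructure F) :
    Q.toBiextriangulated.IsStrong := by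
  intro X X' Y Y' d e
  refine (cup_eq_neg_cup_iff (C := U) _ _ _ _).2 ?_
  generalize hd : ofExt (C := S) d = d'
  generalize he : ofExt (C := T) e = e'
  change ((F.map (ofExt (C := S) d)).app Y ≫ (Q.θ.app X').app Y) ≫
      ((F.obj X').map (ofExt (C := T) e) ≫ (Q.ζ.app X').app Y')⟦(1 : ℤ)⟧' =
    -(((F.obj X).map (ofExt (C := T) e) ≫ (Q.ζ.app X).app Y') ≫
      ((F.map (ofExt (C := S) d)).app Y' ≫ (Q.θ.app X').app Y')⟦(1 : ℤ)⟧')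
  rw [hd, he]
  have hθ : (F.obj (X'⟦(1 : ℤ)⟧)).map e' ≫ (Q.θ.app X').app (Y'⟦(1 : ℤ)⟧) =
      (Q.θ.app X').app Y ≫ ((F.obj X').map e')⟦(1 : ℤ)⟧' := (Q.θ.app X').naturality e'
  have hζ : (F.map d').app (Y'⟦(1 : ℤ)⟧) ≫ (Q.ζ.app (X'⟦(1 : ℤ)⟧)).app Y' =
      (Q.ζ.app X).app Y' ≫ ((F.map d').app Y')⟦(1 : ℤ)⟧' :=
    NatTrans.congr_app (Q.ζ.naturality d') Y'
  -- both sides are `F(d, e)` followed by a side of the anticommutativity relation at `(X', Y')`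
  calc
    _ = (F.map d').app Y ≫ ((Q.θ.app X').app Y ≫ ((F.obj X').map e')⟦(1 : ℤ)⟧') ≫
        ((Q.ζ.app X').app Y')⟦(1 : ℤ)⟧' := by
      simp only [Functor.map_comp, Category.assoc]
    _ = ((F.map d').app Y ≫ (F.obj (X'⟦(1 : ℤ)⟧)).map e') ≫
        (Q.θ.app X').app (Y'⟦(1 : ℤ)⟧) ≫ ((Q.ζ.app X').app Y')⟦(1 : ℤ)⟧' := by
      rw [← hθ]
      simp only [Category.assoc]
    _ = -((F.obj X).map e' ≫ ((F.map d').app (Y'⟦(1 : ℤ)⟧) ≫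
        (Q.ζ.app (X'⟦(1 : ℤ)⟧)).app Y') ≫ ((Q.θ.app X').app Y')⟦(1 : ℤ)⟧') := by
      rw [Q.anticomm, ← NatTrans.naturality, Preadditive.comp_neg]
      simp only [Category.assoc]
    _ = _ := by
      rw [hζ]
      simp only [Functor.map_comp, Category.assoc]

variable (F) in
/-- Strong biextriangulated structures and bitriangulated structures on `F` correspond
bijectively. -/
def strongBiextriangulatedEquiv :
    {P : BiextriangulatedStructure (triangulatedStructure S) (triangulatedStructure T)
      (triangulatedStructure U) F // P.IsStrong} ≃ BitriangulatedStructure F where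
  toFun P := P.1.toBitriangulated P.2
  invFun Q := ⟨Q.toBiextriangulated, Q.isStrong_toBiextriangulated⟩
  left_inv P := by
    apply Subtype.ext
    apply BiextriangulatedStructure.ext
    · funext Y
      apply ExtTrans.ext
      funext X' X
      apply AddMonoidHom.ext
      intro d
      exact (ofExt_app_eq (P.1.φ Y) (ofExt (C := S) d)).symm
    · funext X
      apply ExtTrans.ext
      funext Y' Y
      apply AddMonoidHom.ext
      intro e
      exact (ofExt_app_eq (P.1.ψ X) (ofExt (C := T) e)).symm
  right_inv Q := by
    apply BitriangulatedStructure.ext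
    · ext X Y
      change (F.map (𝟙 (X⟦(1 : ℤ)⟧))).app Y ≫ (Q.θ.app X).app Y = (Q.θ.app X).app Y
      rw [F.map_id, NatTrans.id_app, Category.id_comp]
    · ext X Y
      change (F.obj X).map (𝟙 (Y⟦(1 : ℤ)⟧)) ≫ (Q.ζ.app X).app Y = (Q.ζ.app X).app Y
      rw [(F.obj X).map_id, Category.id_comp]

end Bi

end Extriangulated

end

theorem mainTheorem6
    {S : Type u₁} [Category.{v₁} S] [Preadditive S] [HasZeroObject S] [HasShift S ℤ]
    [∀ n : ℤ, (shiftFunctor S n).Additive] [Pretriangulated S] [IsTriangulated S]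
    {T : Type u₂} [Category.{v₂} T] [Preadditive T] [HasZeroObject T] [HasShift T ℤ]
    [∀ n : ℤ, (shiftFunctor T n).Additive] [Pretriangulated T] [IsTriangulated T]
    {U : Type u₃} [Category.{v₃} U] [Preadditive U] [HasZeroObject U] [HasShift U ℤ]
    [∀ n : ℤ, (shiftFunctor U n).Additive] [Pretriangulated U] [IsTriangulated U]
    (F : S ⥤ T ⥤ U) :
    ∃ e : {P : Extriangulated.BiextriangulatedStructure
            (Extriangulated.triangulatedStructure S) (Extriangulated.triangulatedStructure T)
            (Extriangulated.triangulatedStructure U) F // P.IsStrong} ≃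
          Extriangulated.BitriangulatedStructure F,
      (∀ (P : {P : Extriangulated.BiextriangulatedStructure
            (Extriangulated.triangulatedStructure S) (Extriangulated.triangulatedStructure T)
            (Extriangulated.triangulatedStructure U) F // P.IsStrong}) (X : S) (Y : T),
        ((e P).θ.app X).app Y =
          Extriangulated.ofExt ((P.1.φ Y).app (X⟦(1 : ℤ)⟧) X
            (Extriangulated.toExt (𝟙 (X⟦(1 : ℤ)⟧)))) ∧
        ((e P).ζ.app X).app Y =
          Extriangulated.ofExt ((P.1.ψ X).app (Y⟦(1 : ℤ)⟧) Y
            (Extriangulated.toExt (𝟙 (Y⟦(1 : ℤ)⟧))))) ∧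
      (∀ Q : Extriangulated.BitriangulatedStructure F,
        (∀ (X' X : S) (Y : T) (f : X' ⟶ X⟦(1 : ℤ)⟧),
          Extriangulated.ofExt (((e.symm Q).1.φ Y).app X' X (Extriangulated.toExt f)) =
            (F.map f).app Y ≫ (Q.θ.app X).app Y) ∧
        (∀ (X : S) (Y' Y : T) (g : Y' ⟶ Y⟦(1 : ℤ)⟧),
          Extriangulated.ofExt (((e.symm Q).1.ψ X).app Y' Y (Extriangulated.toExt g)) =
            (F.obj X).map g ≫ (Q.ζ.app X).app Y)) := by
  exact ⟨Extriangulated.strongBiextriangulatedEquiv F, fun _ _ _ => ⟨rfl, rfl⟩,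
    fun _ => ⟨fun _ _ _ _ => rfl, fun _ _ _ _ => rfl⟩⟩
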